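/- **Theorem 2.4.** Let $n,m\ge 1$. Let $H^t(n,m)$ be the hexagonal lattice with toroidal boundary condition: the graph with vertices $A_{i,j},B_{i,j}$, $(i,j)\in\mathbb Z_{n+1}\times\mathbb Z_{m+1}$, in which $A_{i,j}$ is adjacent to $B_{i,j}$, $B_{i+1,j}$ and $B_{i,j-1}$. The toroidal 3-12-12 lattice $T^t(n,m)$ is the clique-inserted graph of $H^t(n,m)$: each vertex $v$ is replaced by a triangle with one vertex for each edge at $v$, and for each edge $e=uv$ of $H^t(n,m)$ the vertex of the triangle of $u$ that belongs to $e$ is joined to the vertex of the triangle of $v$ that belongs to $e$. The cylindrical lattice $T^c(n,m)$ is obtained from $T^t(n,m)$ by deleting the $n+1$ edges that come from the wrap-around edges $A_{i,0}B_{i,m}$ $(0\le i\le n)$ of $H^t(n,m)$, and the free lattice $T^f(n,m)$ is obtained from $T^c(n,m)$ by deleting also the $m+1$ edges that come from $A_{n,j}B_{0,j}$ $(0\le j\le m)$. The energy $\mathcal E(G)$ of a finite graph $G$ is the sum of the absolute values of the eigenvalues of its adjacency matrix, counted with multiplicity. Then $$\lim_{n,m\to\infty}\frac{\mathcal E(T^t(n,m))}{6mn}=\lim_{n,m\to\infty}\frac{\mathcal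 E(T^c(n,m))}{6mn}=\lim_{n,m\to\infty}\frac{\mathcal E(T^f(n,m))}{6mn}=L,$$ where $$L=\frac13+\frac1{24\pi^2}\int_0^{2\pi}\!\!\int_0^{2\pi}\Big(\sqrt{13+4\sqrt{3+2\cos x+2\cos y+2\cos(x+y)}}+\sqrt{13-4\sqrt{3+2\cos x+2\cos y+2\cos(x+y)}}\Big)\,dx\,dy,$$ the limits being joint limits as $n$ and $m$ tend to infinity independently. Moreover $L\approx 1.4825$, that is, $|L-1.4825|<0.00005$. -/

import Mathlib

namespace CliqueInsertedLattice

/-- The energy of a finite simple graph: the sum of the absolute values of the eigenvalues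
(with multiplicity) of its adjacency matrix over `ℝ`. -/
noncomputable def energy {V : Type*} [Fintype V] (G : SimpleGraph V) : ℝ := by
  classical exact ∑ v : V, |(G.isHermitian_adjMatrix ℝ).eigenvalues v|

/-- Clique-inserting: every vertex `v` of `G` is replaced by a complete graph on `deg v` vertices,
one for each edge at `v`, and each edge `uv` of `G` joins the copy of `u` to the copy of `v` that
belong to it. The vertex of the new graph that lies in the clique of `v` and belongs to the edge
`vw` is the dart `(v, w)`. Equivalently, this is the line graph of the subdivision of `G`. -/
def cliqueInsert {V : Type*} (G : SimpleGraph V) : SimpleGraph G.Dart :=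
  SimpleGraph.fromRel fun d d' => d.fst = d'.fst ∨ d' = d.symm

/-- Vertices of the hexagonal lattice on the torus: an `(n+1) × (m+1)` array of unit cells with
periodic coordinates, each cell `p` holding two vertices, `Sum.inl p` and `Sum.inr p`. -/
abbrev HexVertex (n m : ℕ) : Type :=
  (ZMod (n + 1) × ZMod (m + 1)) ⊕ (ZMod (n + 1) × ZMod (m + 1))

/-- The bonds of the hexagonal lattice, oriented from the first sublattice to the second: the first
vertex of the cell `(i, j)` is joined to the second vertices of the cells `(i, j)`, `(i + 1, j)`
and `(i, j - 1)`. -/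
def HexBond (n m : ℕ) : HexVertex n m → HexVertex n m → Prop
  | Sum.inl p, Sum.inr q => q = p ∨ q = (p.1 + 1, p.2) ∨ q = (p.1, p.2 - 1)
  | _, _ => False

/-- The hexagonal lattice `H^t(n, m)` with toroidal boundary condition, on `2(n+1)(m+1)` vertices
(a cubic graph as soon as `n, m ≥ 1`). -/
def hexTorus (n m : ℕ) : SimpleGraph (HexVertex n m) :=
  SimpleGraph.fromRel (HexBond n m)

noncomputable instance (n m : ℕ) : DecidableRel (hexTorus n m).Adj := Classical.decRel _

/-- The 3-12-12 lattice `T^t(n, m)` with toroidal boundary condition: the clique-inserted graph of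
`H^t(n, m)`. -/
def toroidalLattice (n m : ℕ) : SimpleGraph (hexTorus n m).Dart :=
  cliqueInsert (hexTorus n m)

/-- The `m + 1` edges `(a_j, a_j^*)` of `T^t(n, m)`: they come from the bonds of `H^t(n, m)` that
wrap around in the first coordinate, from column `n` (that is, `-1`) back to column `0`. -/
def aEdges (n m : ℕ) : Set (Sym2 (hexTorus n m).Dart) :=
  {e | ∃ d : (hexTorus n m).Dart, ∃ j : ZMod (m + 1),
    d.fst = Sum.inl (-1, j) ∧ d.snd = Sum.inr (0, j) ∧ e = s(d, d.symm)}

/-- The `n + 1` edges `(b_i, b_i^*)` of `T^t(n, m)`: they come from the bonds of `H^t(n, m)` that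
wrap around in the second coordinate, from row `0` to row `m` (that is, `-1`). -/
def bEdges (n m : ℕ) : Set (Sym2 (hexTorus n m).Dart) :=
  {e | ∃ d : (hexTorus n m).Dart, ∃ i : ZMod (n + 1),
    d.fst = Sum.inl (i, 0) ∧ d.snd = Sum.inr (i, -1) ∧ e = s(d, d.symm)}

/-- The 3-12-12 lattice `T^c(n, m)` with cylindrical boundary condition. -/
def cylindricalLattice (n m : ℕ) : SimpleGraph (hexTorus n m).Dart :=
  (toroidalLattice n m).deleteEdges (bEdges n m)

/-- The 3-12-12 lattice `T^f(n, m)` with free boundary condition. -/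
def freeLattice (n m : ℕ) : SimpleGraph (hexTorus n m).Dart :=
  (cylindricalLattice n m).deleteEdges (aEdges n m)

/-- `√(3 + 2 cos x + 2 cos y + 2 cos (x + y))`. -/
noncomputable def hexSymbol (x y : ℝ) : ℝ :=
  √(3 + 2 * Real.cos x + 2 * Real.cos y + 2 * Real.cos (x + y))

/-- The asymptotic energy per vertex of the 3-12-12 lattice, as a double integral. -/
noncomputable def asymptoticEnergy : ℝ :=
  1 / 3 + 1 / (24 * Real.pi ^ 2) *
    ∫ x in (0 : ℝ)..(2 * Real.pi), ∫ y in (0 : ℝ)..(2 * Real.pi),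
      (√(13 + 4 * hexSymbol x y) + √(13 - 4 * hexSymbol x y))

end CliqueInsertedLattice

/-! The toroidal spectrum can be computed exactly, and the other two lattices differ from the torus
by boundary terms that vanish after division by `6nm`.

Listing the darts as two copies of the set of bonds, the adjacency matrix of the torus has diagonal
blocks `N₁ᵀN₁ - 1`, `N₂ᵀN₂ - 1` and identity off-diagonal blocks, where `N₁`, `N₂` are the incidence
matrices of the two ends of the bonds. `det_cliqueInsert_blocks` reduces its characteristic
determinant to that of `B * Bᵀ`, with `B = N₁N₂ᵀ` the biadjacency matrix of the hexagonal torus. `B`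
commutes with translations, so characters diagonalise `B * Bᵀ`, with eigenvalues `t = |1 + e^{ix} +
e^{-iy}|²` at grid angles. Each `t` yields the eigenvalues `0`, `-2` and the four roots of `(x² - x
- 3)² = t`. Their absolute values add up to `2 + energySymbol x y`, so the energy is a Riemann sum
over a uniform grid, and `tendsto_gridAverage` gives the limit.

Passing to the cylinder and then to the free lattice deletes `O(n + m)` edges. By
`Matrix.IsHermitian.sum_abs_eigenvalues_le` the energy moves by at most the entrywise `ℓ¹` norm of
the change, which is also `O(n + m)`.

For the numerical value, `energySymbol` is squeezed between two polynomials in `t`, whose torus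
averages are rational combinations of exactly known moments. -/

namespace Matrix

/-! ### Perturbation of the trace norm of a symmetric matrix. -/

variable {V : Type*} [Fintype V] [DecidableEq V]

/-- The diagonal of an orthogonal conjugate of a symmetric matrix has `ℓ¹` norm at most the sum of
the absolute values of the eigenvalues. -/
theorem IsHermitian.sum_abs_diag_conj_le {A : Matrix V V ℝ} (hA : A.IsHermitian)
    {U : Matrix V V ℝ} (hU : Uᵀ * U = 1) :
    ∑ i, |(Uᵀ * A * U) i i| ≤ ∑ i, |hA.eigenvalues i| := by
  set W : Matrix V V ℝ := Uᵀ * (hA.eigenvectorUnitary : Matrix V V ℝ) with hW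
  have hE : (hA.eigenvectorUnitary : Matrix V V ℝ)ᵀ * hA.eigenvectorUnitary = 1 := by
    have := (Unitary.mem_iff.mp hA.eigenvectorUnitary.2).1
    simpa [star_eq_conjTranspose] using this
  have hU' : U * Uᵀ = 1 := mul_eq_one_comm.mp hU
  have hWW : Wᵀ * W = 1 := by
    rw [hW, transpose_mul, transpose_transpose, Matrix.mul_assoc, ← Matrix.mul_assoc U, hU',
      Matrix.one_mul, hE]
  -- Each diagonal entry is a combination of eigenvalues with weights `W i j ^ 2`; since `W` is
  -- orthogonal, the weights of each eigenvalue sum to one.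
  have hdiag : ∀ i, (Uᵀ * A * U) i i = ∑ j, W i j ^ 2 * hA.eigenvalues j := by
    intro i
    have h1 : Uᵀ * A * U = W * diagonal hA.eigenvalues * Wᵀ := by
      conv_lhs => rw [hA.spectral_theorem]
      simp only [Unitary.conjStarAlgAut_apply, hW, transpose_mul, transpose_transpose,
        star_eq_conjTranspose, conjTranspose_eq_transpose_of_trivial, Matrix.mul_assoc]
      rfl
    rw [h1, mul_apply]
    refine Finset.sum_congr rfl fun j _ => ?_
    rw [mul_diagonal, transpose_apply]
    ring
  have hcol : ∀ j, ∑ i, W i j ^ 2 = 1 := by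
    intro j
    have := congrFun (congrFun hWW j) j
    rw [mul_apply, one_apply_eq] at this
    rw [← this]
    exact Finset.sum_congr rfl fun i _ => by rw [transpose_apply, sq]
  calc ∑ i, |(Uᵀ * A * U) i i| ≤ ∑ i, ∑ j, W i j ^ 2 * |hA.eigenvalues j| := by
        refine Finset.sum_le_sum fun i _ => ?_
        rw [hdiag]
        refine (Finset.abs_sum_le_sum_abs _ _).trans (le_of_eq ?_)
        exact Finset.sum_congr rfl fun j _ => by rw [abs_mul, abs_of_nonneg (sq_nonneg _)]
    _ = ∑ j, |hA.eigenvalues j| := by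
        rw [Finset.sum_comm]
        exact Finset.sum_congr rfl fun j _ => by rw [← Finset.sum_mul, hcol, one_mul]

/-- The diagonal of an orthogonal conjugate of a matrix has `ℓ¹` norm at most the entrywise `ℓ¹`
norm of the matrix. -/
theorem sum_abs_diag_conj_le_sum_abs (D : Matrix V V ℝ) {U : Matrix V V ℝ} (hU : Uᵀ * U = 1) :
    ∑ i, |(Uᵀ * D * U) i i| ≤ ∑ a, ∑ b, |D a b| := by
  have hU' : U * Uᵀ = 1 := mul_eq_one_comm.mp hU
  have hrow : ∀ a, ∑ i, U a i ^ 2 = 1 := by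
    intro a
    have := congrFun (congrFun hU' a) a
    rw [mul_apply, one_apply_eq] at this
    rw [← this]
    exact Finset.sum_congr rfl fun i _ => by rw [transpose_apply, sq]
  have hdiag : ∀ i, (Uᵀ * D * U) i i = ∑ a, ∑ b, U a i * D a b * U b i := by
    intro i
    rw [mul_apply, Finset.sum_comm]
    refine Finset.sum_congr rfl fun b _ => ?_
    rw [mul_apply, Finset.sum_mul]
    rfl
  -- The rows of `U` are unit vectors, so AM-GM suffices.
  have hcs : ∀ a b, ∑ i, |U a i| * |U b i| ≤ 1 := by
    intro a b
    calc ∑ i, |U a i| * |U b i| ≤ ∑ i, (U a i ^ 2 + U b i ^ 2) / 2 := by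
          refine Finset.sum_le_sum fun i _ => ?_
          nlinarith [sq_nonneg (|U a i| - |U b i|), sq_abs (U a i), sq_abs (U b i)]
      _ = 1 := by rw [← Finset.sum_div, Finset.sum_add_distrib, hrow, hrow]; norm_num
  calc ∑ i, |(Uᵀ * D * U) i i| ≤ ∑ i, ∑ a, ∑ b, |D a b| * (|U a i| * |U b i|) := by
        refine Finset.sum_le_sum fun i _ => ?_
        rw [hdiag]
        refine (Finset.abs_sum_le_sum_abs _ _).trans (Finset.sum_le_sum fun a _ => ?_)
        refine (Finset.abs_sum_le_sum_abs _ _).trans (le_of_eq ?_)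
        exact Finset.sum_congr rfl fun b _ => by rw [abs_mul, abs_mul]; ring
    _ = ∑ a, ∑ b, |D a b| * ∑ i, |U a i| * |U b i| := by
        rw [Finset.sum_comm]
        refine Finset.sum_congr rfl fun a _ => ?_
        rw [Finset.sum_comm]
        exact Finset.sum_congr rfl fun b _ => by rw [Finset.mul_sum]
    _ ≤ ∑ a, ∑ b, |D a b| :=
        Finset.sum_le_sum fun a _ => Finset.sum_le_sum fun b _ =>
          mul_le_of_le_one_right (abs_nonneg _) (hcs a b)

/-- Stability of the trace norm of a symmetric matrix under entrywise perturbation. -/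
theorem IsHermitian.sum_abs_eigenvalues_le {A B : Matrix V V ℝ} (hA : A.IsHermitian)
    (hB : B.IsHermitian) :
    ∑ i, |hA.eigenvalues i| ≤ ∑ i, |hB.eigenvalues i| + ∑ a, ∑ b, |A a b - B a b| := by
  -- In an eigenbasis of `A` the eigenvalues are diagonal entries, and these split additively along
  -- `A = B + (A - B)`.
  set U : Matrix V V ℝ := hA.eigenvectorUnitary.1 with hUdef
  have hU : Uᵀ * U = 1 := by
    have := (Unitary.mem_iff.mp hA.eigenvectorUnitary.2).1
    simpa [star_eq_conjTranspose] using this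
  have hAU : Uᵀ * A * U = diagonal hA.eigenvalues := by
    have h := hA.spectral_theorem
    rw [Unitary.conjStarAlgAut_apply, star_eq_conjTranspose,
      conjTranspose_eq_transpose_of_trivial, ← hUdef] at h
    conv_lhs => rw [h]
    rw [Matrix.mul_assoc, Matrix.mul_assoc, Matrix.mul_assoc, hU, Matrix.mul_one,
      ← Matrix.mul_assoc, hU, Matrix.one_mul]
    rfl
  have hsplit : ∀ i, hA.eigenvalues i = (Uᵀ * B * U) i i + (Uᵀ * (A - B) * U) i i := by
    intro i
    rw [← add_apply, ← Matrix.add_mul, ← Matrix.mul_add, add_sub_cancel, hAU, diagonal_apply_eq]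
  calc ∑ i, |hA.eigenvalues i|
      ≤ ∑ i, (|(Uᵀ * B * U) i i| + |(Uᵀ * (A - B) * U) i i|) :=
        Finset.sum_le_sum fun i _ => by
          conv_lhs => rw [hsplit i]
          exact abs_add_le _ _
    _ ≤ _ := by
        rw [Finset.sum_add_distrib]
        exact add_le_add (hB.sum_abs_diag_conj_le hU) (sum_abs_diag_conj_le_sum_abs _ hU)

end Matrix

/-! ### Graph energy and edge deletion. -/

namespace CliqueInsertedLattice

theorem energy_eq_sum_abs_eigenvalues {V : Type*} [Fintype V] [DecidableEq V] (G : SimpleGraph V)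
    [DecidableRel G.Adj] : energy G = ∑ v, |(G.isHermitian_adjMatrix ℝ).eigenvalues v| := by
  unfold energy
  congr!

theorem energy_eq_sum_roots {V : Type*} [Fintype V] [DecidableEq V] (G : SimpleGraph V)
    [DecidableRel G.Adj] :
    energy G = ((G.adjMatrix ℝ).charpoly.roots.map fun x => |x|).sum := by
  rw [energy_eq_sum_abs_eigenvalues, (G.isHermitian_adjMatrix ℝ).roots_charpoly_eq_eigenvalues,
    Multiset.map_map]
  rfl

/-- Deleting edges, all of which join some vertex `a ∈ T` to `σ a`, changes the energy by at most
the cardinality of `T`. -/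
theorem abs_energy_deleteEdges_sub_le {V : Type*} [Fintype V] (G : SimpleGraph V)
    (s : Set (Sym2 V)) (T : Finset V) (σ : V → V) (h : ∀ a b, s(a, b) ∈ s → a ∈ T ∧ b = σ a) :
    |energy (G.deleteEdges s) - energy G| ≤ T.card := by
  classical
  have key : ∑ a, ∑ b, |(G.deleteEdges s).adjMatrix ℝ a b - G.adjMatrix ℝ a b| ≤ T.card := by
    have hentry : ∀ a b, |(G.deleteEdges s).adjMatrix ℝ a b - G.adjMatrix ℝ a b| ≤
        if a ∈ T ∧ b = σ a then 1 else 0 := by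
      intro a b
      simp only [SimpleGraph.adjMatrix_apply, SimpleGraph.deleteEdges_adj]
      by_cases hs : s(a, b) ∈ s
      · rw [if_pos (h a b hs)]
        by_cases hG : G.Adj a b <;> simp [hs, hG]
      · simp only [hs, not_false_eq_true, and_true, sub_self, abs_zero]
        split_ifs <;> norm_num
    calc ∑ a, ∑ b, |(G.deleteEdges s).adjMatrix ℝ a b - G.adjMatrix ℝ a b|
        ≤ ∑ a, ∑ b, if a ∈ T ∧ b = σ a then (1 : ℝ) else 0 :=
          Finset.sum_le_sum fun a _ => Finset.sum_le_sum fun b _ => hentry a b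
      _ = ∑ a, if a ∈ T then (1 : ℝ) else 0 := by
          refine Finset.sum_congr rfl fun a _ => ?_
          by_cases ha : a ∈ T <;> simp [ha]
      _ = T.card := by simp
  have key' : ∑ a, ∑ b, |G.adjMatrix ℝ a b - (G.deleteEdges s).adjMatrix ℝ a b| ≤ T.card := by
    simpa only [abs_sub_comm] using key
  have h1 := ((G.deleteEdges s).isHermitian_adjMatrix ℝ).sum_abs_eigenvalues_le
    (G.isHermitian_adjMatrix ℝ)
  have h2 := (G.isHermitian_adjMatrix ℝ).sum_abs_eigenvalues_le
    ((G.deleteEdges s).isHermitian_adjMatrix ℝ)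
  rw [energy_eq_sum_abs_eigenvalues, energy_eq_sum_abs_eigenvalues, abs_le]
  constructor <;> linarith

end CliqueInsertedLattice

/-! ### Characteristic determinant of a clique-inserted bipartite cubic graph. -/

namespace Matrix

variable {P β K : Type*} [Fintype P] [DecidableEq P] [Fintype β] [DecidableEq β] [Field K]

/-- A unipotent column operation turns the upper left block into the identity, after which the Schur
complement needs no invertibility of `A` or `D`. -/
theorem det_fromBlocks_neg_one (A D : Matrix β β K) :
    (fromBlocks A (-1) (-1) D).det = (D * A - 1).det := by
  have h : fromBlocks A (-1) (-1) D * fromBlocks 1 0 (A - 1) 1 =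
      fromBlocks 1 (-1) (-1 + D * (A - 1)) D := by
    rw [fromBlocks_multiply]
    congr 1 <;> simp
  have h1 : (fromBlocks (1 : Matrix β β K) 0 (A - 1) (1 : Matrix β β K)).det = 1 := by
    rw [det_fromBlocks_zero₁₂, det_one, one_mul]
  have h2 := congrArg det h
  rw [det_mul, h1, mul_one, det_fromBlocks_one₁₁] at h2
  rw [h2]
  congr 1
  simp only [Matrix.mul_sub, Matrix.mul_neg, Matrix.mul_one]
  abel

/-- The characteristic determinant of the clique-inserted graph of a bipartite cubic graph. The
columns of `N₁` and `N₂` are the two ends of each edge and `B` is the biadjacency matrix. -/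
theorem det_cliqueInsert_blocks {N₁ N₂ : Matrix P β K} {B : Matrix P P K}
    (h₁ : N₁ * N₁ᵀ = (3 : K) • (1 : Matrix P P K)) (h₂ : N₂ * N₂ᵀ = (3 : K) • (1 : Matrix P P K))
    (hB : N₁ * N₂ᵀ = B) {z w : K} (hz : z ^ 2 - 1 ≠ 0) (hw : w = z ^ 2 - 1 - 3 * z) (hw0 : w ≠ 0) :
    (z ^ 2 - 1) ^ (2 * Fintype.card P) *
      (fromBlocks (z • 1 - N₁ᵀ * N₁) (-1) (-1) (z • 1 - N₂ᵀ * N₂)).det =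
    (z ^ 2 - 1) ^ Fintype.card β * (w ^ 2 • (1 : Matrix P P K) - B * Bᵀ).det := by
  have hBt : N₂ * N₁ᵀ = Bᵀ := by rw [← hB, transpose_mul, transpose_transpose]
  set c := z ^ 2 - 1 with hc
  -- Expanding `(z - N₂ᵀN₂)(z - N₁ᵀN₁) - 1` gives the scalar `c` minus terms that all factor through
  -- `P ⊕ P`. Sylvester's identity `det (1 - UV) = det (1 - VU)` then replaces bonds by vertices.
  set U : Matrix β (P ⊕ P) K := c⁻¹ • fromCols (z • N₁ᵀ - N₂ᵀ * Bᵀ) (z • N₂ᵀ) with hU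
  set V : Matrix (P ⊕ P) β K := fromRows N₁ N₂ with hV
  have hUV : (z • 1 - N₂ᵀ * N₂) * (z • 1 - N₁ᵀ * N₁) - 1 = c • (1 - U * V) := by
    have hUV' : U * V = c⁻¹ • (z • (N₁ᵀ * N₁) - N₂ᵀ * Bᵀ * N₁ + z • (N₂ᵀ * N₂)) := by
      rw [hU, hV, Matrix.smul_mul, fromCols_mul_fromRows, Matrix.sub_mul, Matrix.smul_mul,
        Matrix.smul_mul]
    have hYX : N₂ᵀ * N₂ * (N₁ᵀ * N₁) = N₂ᵀ * Bᵀ * N₁ := by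
      rw [← hBt]; simp only [Matrix.mul_assoc]
    rw [hUV', smul_sub, smul_smul, mul_inv_cancel₀ hz, one_smul, Matrix.sub_mul, Matrix.mul_sub,
      Matrix.mul_sub, hYX, hc]
    simp only [Matrix.smul_mul, Matrix.mul_smul, Matrix.one_mul, Matrix.mul_one, smul_smul]
    module
  have hVU : c • (1 - V * U) =
      fromBlocks (w • 1 + B * Bᵀ) (-(z • B)) ((3 - z) • Bᵀ) (w • 1) := by
    have hVU' : V * U = c⁻¹ • fromBlocks ((3 * z) • 1 - B * Bᵀ) (z • B) ((z - 3) • Bᵀ)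
        ((3 * z) • 1) := by
      rw [hU, hV, Matrix.mul_smul, fromRows_mul_fromCols]
      congr 2
      · rw [Matrix.mul_sub, Matrix.mul_smul, h₁, ← Matrix.mul_assoc, hB, smul_smul, mul_comm z]
      · rw [Matrix.mul_smul, hB]
      · rw [Matrix.mul_sub, Matrix.mul_smul, hBt, ← Matrix.mul_assoc, h₂, Matrix.smul_mul,
          Matrix.one_mul, sub_smul]
      · rw [Matrix.mul_smul, h₂, smul_smul, mul_comm z]
    rw [hVU', smul_sub, smul_smul, mul_inv_cancel₀ hz, one_smul, ← fromBlocks_one,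
      fromBlocks_smul, sub_eq_add_neg, fromBlocks_neg, fromBlocks_add, hw]
    congr 1
    · module
    · simp
    · module
    · module
  have hcard : Fintype.card (P ⊕ P) = 2 * Fintype.card P := by
    rw [Fintype.card_sum, two_mul]
  have hinv : Invertible (w • (1 : Matrix P P K)) :=
    ⟨w⁻¹ • 1, by rw [Matrix.smul_mul, Matrix.one_mul, smul_smul, inv_mul_cancel₀ hw0, one_smul],
      by rw [Matrix.smul_mul, Matrix.one_mul, smul_smul, mul_inv_cancel₀ hw0, one_smul]⟩
  have hinv_eq : ⅟(w • (1 : Matrix P P K)) = w⁻¹ • 1 :=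
    invOf_eq_right_inv
      (by rw [Matrix.smul_mul, Matrix.one_mul, smul_smul, mul_inv_cancel₀ hw0, one_smul])
  rw [det_fromBlocks_neg_one, hUV, det_smul, det_one_sub_mul_comm, mul_left_comm, ← hcard,
    ← det_smul, hVU, det_fromBlocks₂₂, hinv_eq, det_smul, det_one, mul_one, ← det_smul]
  congr 2
  simp only [Matrix.smul_mul, Matrix.mul_smul, Matrix.mul_one, Matrix.neg_mul, smul_add,
    smul_neg, smul_smul, sub_neg_eq_add]
  -- The coefficient of `B * Bᵀ` in the rescaled Schur complement is `w + (3 - z) * z = -1`.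
  have h : w * ((3 - z) * (w⁻¹ * z)) = (3 - z) * z := by field_simp
  rw [h, hw]
  module

end Matrix

/-! ### Translation-invariant incidence matrices and their characters. -/

namespace CliqueInsertedLattice

open Matrix

section Circulant

variable {P : Type*} [Fintype P] [DecidableEq P] {K : Type*} [CommRing K]

/-- The incidence matrix between cells and the first ends of the bonds `(p, r)`. -/
def startInc (P K : Type*) [DecidableEq P] [Zero K] [One K] : Matrix P (P × Fin 3) K :=
  of fun p b => if b.1 = p then 1 else 0

theorem startInc_mul_apply {κ : Type*} (G : Matrix (P × Fin 3) κ K) (p : P) (k : κ) :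
    (startInc P K * G) p k = ∑ r, G (p, r) k := by
  rw [mul_apply, Fintype.sum_prod_type, Finset.sum_comm]
  refine Finset.sum_congr rfl fun r _ => ?_
  simp [startInc]

theorem startInc_transpose_mul_apply {κ : Type*} (F : Matrix P κ K) (b : P × Fin 3) (k : κ) :
    ((startInc P K)ᵀ * F) b k = F b.1 k := by
  rw [mul_apply]
  simp [startInc]

theorem startInc_mul_transpose :
    startInc P K * (startInc P K)ᵀ = (3 : K) • (1 : Matrix P P K) := by
  ext p q
  rw [startInc_mul_apply]
  by_cases h : p = q <;> simp [startInc, one_apply, h]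

/-- The incidence matrix between cells and the second ends `p + c r` of the bonds `(p, r)`. -/
def endInc {P : Type*} [AddCommGroup P] [DecidableEq P] (K : Type*) [Zero K] [One K]
    (c : Fin 3 → P) : Matrix P (P × Fin 3) K :=
  of fun p b => if b.1 + c b.2 = p then 1 else 0

variable [AddCommGroup P]

theorem endInc_mul_apply {κ : Type*} (c : Fin 3 → P) (G : Matrix (P × Fin 3) κ K) (q : P) (k : κ) :
    (endInc K c * G) q k = ∑ r, G (q - c r, r) k := by
  rw [mul_apply, Fintype.sum_prod_type, Finset.sum_comm]
  refine Finset.sum_congr rfl fun r _ => ?_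
  simp [endInc, ← eq_sub_iff_add_eq]

theorem endInc_transpose_mul_apply {κ : Type*} (c : Fin 3 → P) (F : Matrix P κ K) (b : P × Fin 3)
    (k : κ) : ((endInc K c)ᵀ * F) b k = F (b.1 + c b.2) k := by
  rw [mul_apply]
  simp [endInc]

theorem endInc_mul_transpose (c : Fin 3 → P) :
    endInc K c * (endInc K c)ᵀ = (3 : K) • (1 : Matrix P P K) := by
  ext p q
  rw [endInc_mul_apply]
  simp [endInc, one_apply]

/-- The biadjacency matrix of the bipartite graph joining `p` to the `p + c r`. -/
def biadj (K : Type*) [CommRing K] (c : Fin 3 → P) : Matrix P P K :=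
  startInc P K * (endInc K c)ᵀ

/-- The characters are common eigenvectors of `B` and `Bᵀ`, with conjugate eigenvalues. Their linear
independence makes the character table `F` invertible, so `det F` cancels. The computation is over
`ℂ` and descends to `ℝ`. -/
theorem det_sub_biadj_mul_transpose (c : Fin 3 → P) (χ : P → AddChar P ℂ)
    (hχ : Function.Injective χ) (y : ℝ) :
    (y • (1 : Matrix P P ℝ) - biadj ℝ c * (biadj ℝ c)ᵀ).det =
      ∏ k, (y - Complex.normSq (∑ r, χ k (c r))) := by
  set F : Matrix P P ℂ := of fun p k => χ k p with hF
  have hdet : F.det ≠ 0 := by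
    have h := (AddChar.linearIndependent P ℂ).comp χ hχ
    have h2 : IsUnit F := by
      rw [← linearIndependent_cols_iff_isUnit]
      exact h
    exact ((isUnit_iff_isUnit_det F).mp h2).ne_zero
  set b : P → ℂ := fun k => ∑ r, χ k (c r) with hb
  have h1 : biadj ℂ c * F = F * diagonal b := by
    ext p k
    rw [biadj, Matrix.mul_assoc, startInc_mul_apply, mul_diagonal]
    simp only [endInc_transpose_mul_apply, hF, hb, of_apply, AddChar.map_add_eq_mul, Finset.mul_sum]
  have h2 : (biadj ℂ c)ᵀ * F = F * diagonal fun k => (starRingEnd ℂ) (b k) := by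
    ext p k
    rw [biadj, transpose_mul, transpose_transpose, Matrix.mul_assoc, endInc_mul_apply, mul_diagonal]
    simp only [startInc_transpose_mul_apply, hF, hb, of_apply, map_sum, Finset.mul_sum,
      sub_eq_add_neg, AddChar.map_add_eq_mul, AddChar.map_neg_eq_conj]
  have h3 : ((y : ℂ) • (1 : Matrix P P ℂ) - biadj ℂ c * (biadj ℂ c)ᵀ) * F =
      F * diagonal fun k => (y : ℂ) - Complex.normSq (b k) := by
    rw [Matrix.sub_mul, Matrix.mul_assoc, h2, ← Matrix.mul_assoc, h1, Matrix.mul_assoc,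
      diagonal_mul_diagonal, Matrix.smul_mul, Matrix.one_mul]
    ext p k
    simp only [Matrix.sub_apply, Matrix.smul_apply, mul_diagonal, Complex.mul_conj, smul_eq_mul]
    ring
  have h4 := congrArg det h3
  rw [det_mul, det_mul, mul_comm, det_diagonal] at h4
  have h5 := mul_left_cancel₀ hdet h4
  have hmap : ((y • (1 : Matrix P P ℝ) - biadj ℝ c * (biadj ℝ c)ᵀ)).map (algebraMap ℝ ℂ) =
      (y : ℂ) • (1 : Matrix P P ℂ) - biadj ℂ c * (biadj ℂ c)ᵀ := by
    have hs : (startInc P ℝ).map (algebraMap ℝ ℂ) = startInc P ℂ := by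
      ext; simp [startInc, apply_ite]
    have he : (endInc ℝ c).map (algebraMap ℝ ℂ) = endInc ℂ c := by
      ext; simp [endInc, apply_ite]
    have hB : (biadj ℝ c).map (algebraMap ℝ ℂ) = biadj ℂ c := by
      rw [biadj, Matrix.map_mul, transpose_map, hs, he, biadj]
    rw [← hB, ← transpose_map, ← Matrix.map_mul]
    ext p q
    by_cases hpq : p = q <;> simp [hpq, one_apply]
  apply Complex.ofReal_injective
  have h6 : ((y • (1 : Matrix P P ℝ) - biadj ℝ c * (biadj ℝ c)ᵀ).det : ℂ) =
      algebraMap ℝ ℂ (y • (1 : Matrix P P ℝ) - biadj ℝ c * (biadj ℝ c)ᵀ).det := rfl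
  rw [h6, RingHom.map_det, RingHom.mapMatrix_apply, hmap, h5]
  push_cast
  rfl

end Circulant

end CliqueInsertedLattice

/-! ### Darts of the hexagonal torus and the block form of the adjacency matrix. -/

namespace CliqueInsertedLattice

open Matrix

/-- The cells of the hexagonal lattice. -/
abbrev Cell (n m : ℕ) : Type := ZMod (n + 1) × ZMod (m + 1)

/-- The displacements between the cells of the two ends of a bond. -/
def hexShift (n m : ℕ) : Fin 3 → Cell n m := ![0, (1, 0), (0, -1)]

/-- If `n` or `m` were `0`, then `1 = 0` in that coordinate and two of the three bonds at a vertex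
would coincide. -/
theorem hexShift_injective {n m : ℕ} (hn : 1 ≤ n) (hm : 1 ≤ m) :
    Function.Injective (hexShift n m) := by
  have : Fact (1 < n + 1) := ⟨by omega⟩
  have : Fact (1 < m + 1) := ⟨by omega⟩
  intro r s h
  fin_cases r <;> fin_cases s <;> simp [hexShift, Prod.ext_iff] at h ⊢

theorem hexBond_inl_inr_iff {n m : ℕ} (p q : Cell n m) :
    HexBond n m (Sum.inl p) (Sum.inr q) ↔ ∃ r, q = p + hexShift n m r := by
  simp [HexBond, hexShift, Fin.exists_fin_succ, Prod.ext_iff, sub_eq_add_neg]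

theorem hexTorus_adj_inl_inr {n m : ℕ} (p q : Cell n m) :
    (hexTorus n m).Adj (Sum.inl p) (Sum.inr q) ↔ ∃ r, q = p + hexShift n m r := by
  rw [← hexBond_inl_inr_iff]
  simp [hexTorus, HexBond]

theorem hexTorus_not_adj_inl_inl {n m : ℕ} (p q : Cell n m) :
    ¬ (hexTorus n m).Adj (Sum.inl p) (Sum.inl q) := by
  simp [hexTorus, HexBond]

theorem hexTorus_not_adj_inr_inr {n m : ℕ} (p q : Cell n m) :
    ¬ (hexTorus n m).Adj (Sum.inr p) (Sum.inr q) := by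
  simp [hexTorus, HexBond]

/-- The dart of the bond `(p, r)` that starts in the first sublattice. -/
def bondDart (n m : ℕ) (b : Cell n m × Fin 3) : (hexTorus n m).Dart :=
  ⟨(Sum.inl b.1, Sum.inr (b.1 + hexShift n m b.2)), (hexTorus_adj_inl_inr _ _).mpr ⟨b.2, rfl⟩⟩

/-- The darts of the hexagonal lattice, as two copies of the set of bonds. -/
def dartOfSum (n m : ℕ) : (Cell n m × Fin 3) ⊕ (Cell n m × Fin 3) → (hexTorus n m).Dart :=
  Sum.elim (bondDart n m) fun b => (bondDart n m b).symm

@[simp]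
theorem dartOfSum_inl_fst {n m : ℕ} (b : Cell n m × Fin 3) :
    (dartOfSum n m (Sum.inl b)).fst = Sum.inl b.1 := rfl

@[simp]
theorem dartOfSum_inr_fst {n m : ℕ} (b : Cell n m × Fin 3) :
    (dartOfSum n m (Sum.inr b)).fst = Sum.inr (b.1 + hexShift n m b.2) := rfl

theorem dartOfSum_swap {n m : ℕ} (x : (Cell n m × Fin 3) ⊕ (Cell n m × Fin 3)) :
    (dartOfSum n m x).symm = dartOfSum n m x.swap := by
  rcases x with b | b
  · rfl
  · exact SimpleGraph.Dart.symm_symm _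

theorem dartOfSum_bijective {n m : ℕ} (hn : 1 ≤ n) (hm : 1 ≤ m) :
    Function.Bijective (dartOfSum n m) := by
  have hinj : Function.Injective (bondDart n m) := by
    rintro ⟨p, r⟩ ⟨q, s⟩ h
    have h1 : p = q := Sum.inl_injective (congrArg (fun d => d.fst) h)
    have h2 : p + hexShift n m r = q + hexShift n m s :=
      Sum.inr_injective (congrArg (fun d => d.snd) h)
    subst h1
    rw [hexShift_injective hn hm (add_left_cancel h2)]
  refine ⟨?_, ?_⟩
  · rintro (a | a) (b | b) h
    · exact congrArg _ (hinj h)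
    · have := congrArg (fun d => d.fst) h
      simp at this
    · have := congrArg (fun d => d.fst) h
      simp at this
    · exact congrArg _ (hinj (SimpleGraph.Dart.symm_involutive.injective h))
  · rintro ⟨⟨u, v⟩, h⟩
    rcases u with p | p <;> rcases v with q | q
    · exact absurd h (hexTorus_not_adj_inl_inl _ _)
    · obtain ⟨r, rfl⟩ := (hexTorus_adj_inl_inr _ _).mp h
      exact ⟨Sum.inl (p, r), rfl⟩
    · obtain ⟨r, rfl⟩ := (hexTorus_adj_inl_inr _ _).mp h.symm
      exact ⟨Sum.inr (q, r), rfl⟩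
    · exact absurd h (hexTorus_not_adj_inr_inr _ _)

theorem cliqueInsert_adj {V : Type*} (G : SimpleGraph V) (d d' : G.Dart) :
    (cliqueInsert G).Adj d d' ↔ d ≠ d' ∧ (d.fst = d'.fst ∨ d' = d.symm) := by
  rw [cliqueInsert, SimpleGraph.fromRel_adj]
  refine and_congr_right fun _ => ⟨?_, Or.inl⟩
  rintro (h | h | h)
  · exact h
  · exact Or.inl h.symm
  · exact Or.inr (by rw [h, SimpleGraph.Dart.symm_symm])

open scoped Classical in
theorem adjMatrix_toroidalLattice_submatrix {n m : ℕ} (hn : 1 ≤ n) (hm : 1 ≤ m) :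
    ((toroidalLattice n m).adjMatrix ℝ).submatrix (dartOfSum n m) (dartOfSum n m) =
      fromBlocks ((startInc (Cell n m) ℝ)ᵀ * startInc (Cell n m) ℝ - 1) 1 1
        ((endInc ℝ (hexShift n m))ᵀ * endInc ℝ (hexShift n m) - 1) := by
  have hinj := (dartOfSum_bijective hn hm).1
  ext x y
  rw [submatrix_apply, SimpleGraph.adjMatrix_apply, toroidalLattice, cliqueInsert_adj,
    dartOfSum_swap, hinj.ne_iff, hinj.eq_iff]
  rcases x with a | a <;> rcases y with b | b
  · rw [fromBlocks_apply₁₁, Matrix.sub_apply, startInc_transpose_mul_apply]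
    simp only [startInc, of_apply, one_apply, dartOfSum_inl_fst, Sum.inl.injEq, Sum.swap_inl,
      reduceCtorEq, or_false, ne_eq]
    by_cases h : a = b
    · simp [h]
    · by_cases h' : a.1 = b.1 <;> simp [h, h', eq_comm]
  · simp [one_apply, eq_comm]
  · simp [one_apply, eq_comm]
  · rw [fromBlocks_apply₂₂, Matrix.sub_apply, endInc_transpose_mul_apply]
    simp only [endInc, of_apply, one_apply, dartOfSum_inr_fst, Sum.inr.injEq, Sum.swap_inr,
      reduceCtorEq, or_false, ne_eq]
    by_cases h : a = b
    · simp [h]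
    · by_cases h' : a.1 + hexShift n m a.2 = b.1 + hexShift n m b.2
      · simp [h, h']
      · simp [h, h', eq_comm]

/-! ### Fourier analysis on the group of cells. -/

/-- The characters of the group of cells. -/
noncomputable def cellChar (n m : ℕ) (k : Cell n m) : AddChar (Cell n m) ℂ :=
  (AddChar.mulShift ZMod.stdAddChar k.1).compAddMonoidHom (AddMonoidHom.fst _ _) *
    (AddChar.mulShift ZMod.stdAddChar k.2).compAddMonoidHom (AddMonoidHom.snd _ _)

theorem cellChar_apply {n m : ℕ} (k p : Cell n m) :
    cellChar n m k p = ZMod.stdAddChar (k.1 * p.1) * ZMod.stdAddChar (k.2 * p.2) := rfl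

theorem cellChar_injective (n m : ℕ) : Function.Injective (cellChar n m) := by
  intro k l h
  have h1 := DFunLike.congr_fun h (1, 0)
  have h2 := DFunLike.congr_fun h (0, 1)
  simp only [cellChar_apply, mul_one, mul_zero, AddChar.map_zero_eq_one, one_mul] at h1 h2
  exact Prod.ext (ZMod.injective_stdAddChar h1) (ZMod.injective_stdAddChar h2)

/-- `3 + 2 cos x + 2 cos y + 2 cos (x + y)`, the square of `hexSymbol`. -/
noncomputable def hexSymbolSq (x y : ℝ) : ℝ :=
  3 + 2 * Real.cos x + 2 * Real.cos y + 2 * Real.cos (x + y)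

/-- The right side is `|1 + e^{ix} + e^{-iy}|²`, the form in which the character sum produces the
symbol. -/
theorem hexSymbolSq_eq (x y : ℝ) :
    hexSymbolSq x y =
      (1 + Real.cos x + Real.cos y) ^ 2 + (Real.sin x - Real.sin y) ^ 2 := by
  rw [hexSymbolSq, Real.cos_add]
  nlinarith [Real.sin_sq_add_cos_sq x, Real.sin_sq_add_cos_sq y]

theorem hexSymbolSq_nonneg (x y : ℝ) : 0 ≤ hexSymbolSq x y := by
  rw [hexSymbolSq_eq]
  positivity

theorem hexSymbolSq_le (x y : ℝ) : hexSymbolSq x y ≤ 9 := by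
  rw [hexSymbolSq]
  linarith [Real.cos_le_one x, Real.cos_le_one y, Real.cos_le_one (x + y)]

/-- The angle of the `j`-th point of the uniform grid with `N` points on the circle. -/
noncomputable def gridAngle (N j : ℕ) : ℝ := 2 * Real.pi * j / N

theorem stdAddChar_eq_gridAngle {N : ℕ} (k : ZMod (N + 1)) :
    (ZMod.stdAddChar k : ℂ) = Real.cos (gridAngle (N + 1) k.val) +
      Real.sin (gridAngle (N + 1) k.val) * Complex.I := by
  rw [ZMod.stdAddChar_apply, ZMod.toCircle_apply, Complex.ofReal_cos, Complex.ofReal_sin,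
    ← Complex.exp_mul_I, gridAngle]
  congr 1
  push_cast
  ring

theorem normSq_sum_cellChar {n m : ℕ} (k : Cell n m) :
    Complex.normSq (∑ r, cellChar n m k (hexShift n m r)) =
      hexSymbolSq (gridAngle (n + 1) k.1.val) (gridAngle (m + 1) k.2.val) := by
  have h : ∑ r, cellChar n m k (hexShift n m r) =
      1 + ZMod.stdAddChar k.1 + (starRingEnd ℂ) (ZMod.stdAddChar k.2) := by
    rw [← AddChar.map_neg_eq_conj]
    simp [Fin.sum_univ_three, cellChar_apply, hexShift]
  have h' : ∑ r, cellChar n m k (hexShift n m r) =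
      ((1 + Real.cos (gridAngle (n + 1) k.1.val) + Real.cos (gridAngle (m + 1) k.2.val) : ℝ) : ℂ) +
        ((Real.sin (gridAngle (n + 1) k.1.val) - Real.sin (gridAngle (m + 1) k.2.val) : ℝ) : ℂ) *
          Complex.I := by
    rw [h, stdAddChar_eq_gridAngle, stdAddChar_eq_gridAngle, map_add, map_mul, Complex.conj_ofReal,
      Complex.conj_ofReal, Complex.conj_I]
    push_cast
    ring
  rw [h', Complex.normSq_add_mul_I, hexSymbolSq_eq]

/-! ### Spectrum and energy of the toroidal lattice. -/

/-- The six eigenvalues contributed to the toroidal lattice by one momentum with squared hexagonal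
eigenvalue `t`. -/
noncomputable def latticeEigenvalue (t : ℝ) : Fin 6 → ℝ :=
  ![0, -2, (1 + √(13 + 4 * √t)) / 2, (1 - √(13 + 4 * √t)) / 2,
    (1 + √(13 - 4 * √t)) / 2, (1 - √(13 - 4 * √t)) / 2]

theorem sqrt_le_three {t : ℝ} (ht : t ≤ 9) : √t ≤ 3 := by
  rw [Real.sqrt_le_left (by norm_num)]
  linarith

/-- The quartic factor splits as `x² - x - 3 = ±√t`; the bound `t ≤ 9` keeps both discriminants `13
± 4√t` nonnegative. -/
theorem prod_sub_latticeEigenvalue {t : ℝ} (h0 : 0 ≤ t) (h9 : t ≤ 9) (x : ℝ) :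
    ∏ j, (x - latticeEigenvalue t j) = (x * (x + 2)) * ((x ^ 2 - x - 3) ^ 2 - t) := by
  have ht := Real.sq_sqrt h0
  have h3 := sqrt_le_three h9
  have ha := Real.sq_sqrt (show 0 ≤ 13 + 4 * √t by positivity)
  have hb := Real.sq_sqrt (show 0 ≤ 13 - 4 * √t by linarith)
  have e1 : (x - (1 + √(13 + 4 * √t)) / 2) * (x - (1 - √(13 + 4 * √t)) / 2) =
      x ^ 2 - x - 3 - √t := by linear_combination (-1 / 4) * ha
  have e2 : (x - (1 + √(13 - 4 * √t)) / 2) * (x - (1 - √(13 - 4 * √t)) / 2) =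
      x ^ 2 - x - 3 + √t := by linear_combination (-1 / 4) * hb
  calc ∏ j, (x - latticeEigenvalue t j)
      = (x * (x + 2)) * (((x - (1 + √(13 + 4 * √t)) / 2) * (x - (1 - √(13 + 4 * √t)) / 2)) *
        ((x - (1 + √(13 - 4 * √t)) / 2) * (x - (1 - √(13 - 4 * √t)) / 2))) := by
        simp only [Fin.prod_univ_six, latticeEigenvalue]
        simp
        ring
    _ = _ := by
        rw [e1, e2]
        linear_combination (-(x * (x + 2))) * ht

/-- For `t ≤ 9` both square roots are at least `1`, which fixes every sign; each pair `(1 ± s) / 2`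
then contributes `s`, and `-2` contributes the constant. -/
theorem sum_abs_latticeEigenvalue {t : ℝ} (h9 : t ≤ 9) :
    ∑ j, |latticeEigenvalue t j| = 2 + (√(13 + 4 * √t) + √(13 - 4 * √t)) := by
  have h3 := sqrt_le_three h9
  have h0 := Real.sqrt_nonneg t
  have ha : 1 ≤ √(13 + 4 * √t) := Real.one_le_sqrt.mpr (by linarith)
  have hb : 1 ≤ √(13 - 4 * √t) := Real.one_le_sqrt.mpr (by linarith)
  simp only [Fin.sum_univ_six, latticeEigenvalue, cons_val_zero, cons_val_one, cons_val]
  rw [abs_of_nonneg (show 0 ≤ (1 + √(13 + 4 * √t)) / 2 by linarith),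
    abs_of_nonpos (show (1 - √(13 + 4 * √t)) / 2 ≤ 0 by linarith),
    abs_of_nonneg (show 0 ≤ (1 + √(13 - 4 * √t)) / 2 by linarith),
    abs_of_nonpos (show (1 - √(13 - 4 * √t)) / 2 ≤ 0 by linarith)]
  norm_num
  ring

open scoped Classical in
theorem eval_charpoly_toroidalLattice {n m : ℕ} (hn : 1 ≤ n) (hm : 1 ≤ m) {x : ℝ} (hx : 10 < x) :
    ((toroidalLattice n m).adjMatrix ℝ).charpoly.eval x =
      ∏ k : Cell n m, ((x * (x + 2)) * ((x ^ 2 - x - 3) ^ 2 -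
        hexSymbolSq (gridAngle (n + 1) k.1.val) (gridAngle (m + 1) k.2.val))) := by
  let e := Equiv.ofBijective _ (dartOfSum_bijective hn hm)
  -- The determinant formula is applied with `z = x + 1`, so `z ^ 2 - 1 = x * (x + 2)` and `w = x ^
  -- 2 - x - 3`; large `x` avoids the zeros of both.
  have hz : (x + 1) ^ 2 - 1 ≠ 0 := by nlinarith
  have hw : x ^ 2 - x - 3 ≠ 0 := by nlinarith
  have hdet := det_cliqueInsert_blocks (startInc_mul_transpose (P := Cell n m) (K := ℝ))
    (endInc_mul_transpose (K := ℝ) (hexShift n m)) (B := biadj ℝ (hexShift n m)) rfl hz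
    (show x ^ 2 - x - 3 = (x + 1) ^ 2 - 1 - 3 * (x + 1) by ring) hw
  have hblocks : scalar _ x - reindex e.symm e.symm ((toroidalLattice n m).adjMatrix ℝ) =
      fromBlocks ((x + 1) • 1 - (startInc (Cell n m) ℝ)ᵀ * startInc (Cell n m) ℝ) (-1) (-1)
        ((x + 1) • 1 - (endInc ℝ (hexShift n m))ᵀ * endInc ℝ (hexShift n m)) := by
    have h := adjMatrix_toroidalLattice_submatrix hn hm
    rw [reindex_apply, Equiv.symm_symm]
    change scalar _ x - ((toroidalLattice n m).adjMatrix ℝ).submatrix (dartOfSum n m)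
      (dartOfSum n m) = _
    rw [h, scalar_apply, ← smul_one_eq_diagonal, ← fromBlocks_one, fromBlocks_smul, sub_eq_add_neg,
      fromBlocks_neg, fromBlocks_add]
    congr 1
    · module
    · simp
    · simp
    · module
  rw [← charpoly_reindex e.symm, eval_charpoly, hblocks]
  have hcard : Fintype.card (Cell n m × Fin 3) = 2 * Fintype.card (Cell n m) +
      Fintype.card (Cell n m) := by
    rw [Fintype.card_prod, Fintype.card_fin]; ring
  -- There are three bonds per cell, so cancelling the power for two leaves one factor `x * (x + 2)`
  -- per momentum.
  rw [det_sub_biadj_mul_transpose _ _ (cellChar_injective n m), hcard, pow_add, mul_assoc] at hdet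
  rw [mul_left_cancel₀ (pow_ne_zero _ hz) hdet, Finset.prod_mul_distrib, Finset.prod_const,
    Finset.card_univ]
  simp only [normSq_sum_cellChar]
  congr 2
  ring

open scoped Classical in
theorem charpoly_toroidalLattice {n m : ℕ} (hn : 1 ≤ n) (hm : 1 ≤ m) :
    ((toroidalLattice n m).adjMatrix ℝ).charpoly =
      ∏ k : Cell n m × Fin 6, (Polynomial.X - Polynomial.C (latticeEigenvalue
        (hexSymbolSq (gridAngle (n + 1) k.1.1.val) (gridAngle (m + 1) k.1.2.val)) k.2)) := by
  refine Polynomial.eq_of_infinite_eval_eq _ _ ((Set.Ioi_infinite (10 : ℝ)).mono fun x hx => ?_)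
  rw [Set.mem_ofPred_eq, eval_charpoly_toroidalLattice hn hm hx, Polynomial.eval_prod]
  refine Eq.trans ?_ (Fintype.prod_prod_type (α₁ := Cell n m) (α₂ := Fin 6) _).symm
  refine Fintype.prod_congr _ _ fun k => ?_
  simp only [Polynomial.eval_sub, Polynomial.eval_X, Polynomial.eval_C]
  rw [prod_sub_latticeEigenvalue (hexSymbolSq_nonneg _ _) (hexSymbolSq_le _ _)]

/-- The energy density of the clique-inserted lattice at a momentum. -/
noncomputable def energySymbol (x y : ℝ) : ℝ :=
  √(13 + 4 * hexSymbol x y) + √(13 - 4 * hexSymbol x y)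

theorem energy_toroidalLattice {n m : ℕ} (hn : 1 ≤ n) (hm : 1 ≤ m) :
    energy (toroidalLattice n m) = ∑ j ∈ Finset.range (n + 1), ∑ l ∈ Finset.range (m + 1),
      (2 + energySymbol (gridAngle (n + 1) j) (gridAngle (m + 1) l)) := by
  classical
  rw [energy_eq_sum_roots, charpoly_toroidalLattice hn hm]
  have hroots := Polynomial.roots_multiset_prod_X_sub_C
    ((Finset.univ : Finset (Cell n m × Fin 6)).val.map fun k => latticeEigenvalue
        (hexSymbolSq (gridAngle (n + 1) k.1.1.val) (gridAngle (m + 1) k.1.2.val)) k.2)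
  rw [Multiset.map_map] at hroots
  rw [Finset.prod_eq_multiset_prod]
  erw [hroots]
  rw [Multiset.map_map]
  change ∑ k : Cell n m × Fin 6, |latticeEigenvalue
        (hexSymbolSq (gridAngle (n + 1) k.1.1.val) (gridAngle (m + 1) k.1.2.val)) k.2| = _
  rw [Fintype.sum_prod_type]
  simp only [sum_abs_latticeEigenvalue (hexSymbolSq_le _ _)]
  rw [Fintype.sum_prod_type]
  -- `ZMod (N + 1)` is definitionally `Fin (N + 1)`.
  have hZ : ∀ (N : ℕ) (f : ℕ → ℝ), ∑ k : ZMod (N + 1), f k.val = ∑ j ∈ Finset.range (N + 1), f j :=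
    fun N f => Fin.sum_univ_eq_sum_range f (N + 1)
  have hZ2 := hZ n fun j => ∑ l : ZMod (m + 1),
    (2 + energySymbol (gridAngle (n + 1) j) (gridAngle (m + 1) l.val))
  refine Eq.trans hZ2 (Finset.sum_congr rfl fun j _ => ?_)
  exact hZ m fun l => (2 + energySymbol (gridAngle (n + 1) j) (gridAngle (m + 1) l))

end CliqueInsertedLattice

/-! ### Riemann sums on the torus. -/

namespace CliqueInsertedLattice

open Filter Topology MeasureTheory

section RiemannSums

theorem gridAngle_mem {N j : ℕ} (hN : 0 < N) (hj : j ≤ N) :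
    gridAngle N j ∈ Set.Icc 0 (2 * Real.pi) := by
  have hN' : (0 : ℝ) < N := by exact_mod_cast hN
  have hj' : (j : ℝ) ≤ N := by exact_mod_cast hj
  rw [gridAngle]
  refine ⟨by positivity, ?_⟩
  rw [div_le_iff₀ hN']
  exact mul_le_mul_of_nonneg_left hj' (by positivity)

theorem gridAngle_succ_sub (N j : ℕ) :
    gridAngle N (j + 1) - gridAngle N j = 2 * Real.pi / N := by
  simp only [gridAngle]
  push_cast
  ring

theorem abs_integral_sub_riemannSum_le {f : ℝ → ℝ} (hf : Continuous f) {N : ℕ} (hN : 0 < N)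
    {ε : ℝ} (h : ∀ x ∈ Set.Icc 0 (2 * Real.pi), ∀ y ∈ Set.Icc 0 (2 * Real.pi),
      |x - y| ≤ 2 * Real.pi / N → |f x - f y| ≤ ε) :
    |(∫ x in (0 : ℝ)..(2 * Real.pi), f x) -
      2 * Real.pi / N * ∑ j ∈ Finset.range N, f (gridAngle N j)| ≤ 2 * Real.pi * ε := by
  have hN' : (0 : ℝ) < N := by exact_mod_cast hN
  have hstep : 0 ≤ 2 * Real.pi / N := by positivity
  have h0 : gridAngle N 0 = 0 := by simp [gridAngle]
  have hend : gridAngle N N = 2 * Real.pi := by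
    rw [gridAngle]
    field_simp
  have hsum := intervalIntegral.sum_integral_adjacent_intervals (μ := volume) (f := f)
    (a := gridAngle N) (n := N) fun k _ => hf.intervalIntegrable _ _
  rw [h0, hend] at hsum
  rw [← hsum, Finset.mul_sum, ← Finset.sum_sub_distrib]
  refine (Finset.abs_sum_le_sum_abs _ _).trans ?_
  have hcell : ∀ j ∈ Finset.range N,
      |(∫ x in gridAngle N j..gridAngle N (j + 1), f x) - 2 * Real.pi / N * f (gridAngle N j)| ≤
        ε * (2 * Real.pi / N) := by
    intro j hj
    have hj := Finset.mem_range.mp hj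
    have hle : gridAngle N j ≤ gridAngle N (j + 1) := by
      linarith [gridAngle_succ_sub N j]
    have hconst : 2 * Real.pi / N * f (gridAngle N j) =
        ∫ _ in gridAngle N j..gridAngle N (j + 1), f (gridAngle N j) := by
      rw [intervalIntegral.integral_const, gridAngle_succ_sub, smul_eq_mul]
    rw [hconst, ← intervalIntegral.integral_sub (hf.intervalIntegrable _ _)
      (continuous_const.intervalIntegrable _ _)]
    have hbound := intervalIntegral.norm_integral_le_of_norm_le_const (a := gridAngle N j)
      (b := gridAngle N (j + 1)) (C := ε) (f := fun x => f x - f (gridAngle N j)) fun x hx => by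
        rw [Set.uIoc_of_le hle] at hx
        have hmj := gridAngle_mem hN hj.le
        have hmj1 := gridAngle_mem hN (Nat.succ_le_of_lt hj)
        refine h x ⟨hmj.1.trans hx.1.le, hx.2.trans hmj1.2⟩ _ hmj ?_
        rw [abs_of_nonneg (by linarith [hx.1]), ← gridAngle_succ_sub N j]
        linarith [hx.2]
    rw [gridAngle_succ_sub, abs_of_nonneg hstep] at hbound
    exact hbound
  refine (Finset.sum_le_sum hcell).trans (le_of_eq ?_)
  rw [Finset.sum_const, Finset.card_range, nsmul_eq_mul]
  field_simp

/-- The one-variable estimate is used twice: on the inner integral as a function of `x`, then on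
each slice at a grid point. Each use costs `(2π)² ε`. -/
theorem abs_integral_integral_sub_riemannSum_le {f : ℝ → ℝ → ℝ}
    (hf : Continuous (Function.uncurry f)) {N M : ℕ} (hN : 0 < N) (hM : 0 < M) {ε δ : ℝ}
    (hNδ : 2 * Real.pi / N ≤ δ) (hMδ : 2 * Real.pi / M ≤ δ)
    (h : ∀ x ∈ Set.Icc 0 (2 * Real.pi), ∀ x' ∈ Set.Icc 0 (2 * Real.pi),
      ∀ y ∈ Set.Icc 0 (2 * Real.pi), ∀ y' ∈ Set.Icc 0 (2 * Real.pi),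
        |x - x'| ≤ δ → |y - y'| ≤ δ → |f x y - f x' y'| ≤ ε) (hδ : 0 ≤ δ) :
    |(∫ x in (0 : ℝ)..(2 * Real.pi), ∫ y in (0 : ℝ)..(2 * Real.pi), f x y) -
      2 * Real.pi / N * ∑ j ∈ Finset.range N, 2 * Real.pi / M * ∑ l ∈ Finset.range M,
        f (gridAngle N j) (gridAngle M l)| ≤ 2 * (2 * Real.pi) ^ 2 * ε := by
  have hN' : (0 : ℝ) < N := by exact_mod_cast hN
  have hpi := Real.two_pi_pos
  have hfx : ∀ x, Continuous (f x) := fun x => hf.comp (Continuous.prodMk_right x)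
  set g : ℝ → ℝ := fun x => ∫ y in (0 : ℝ)..(2 * Real.pi), f x y with hg
  have hgc : Continuous g :=
    intervalIntegral.continuous_parametric_intervalIntegral_of_continuous' hf _ _
  have hosc : ∀ x ∈ Set.Icc 0 (2 * Real.pi), ∀ x' ∈ Set.Icc 0 (2 * Real.pi),
      |x - x'| ≤ 2 * Real.pi / N → |g x - g x'| ≤ 2 * Real.pi * ε := by
    intro x hx x' hx' hxx
    rw [hg, ← intervalIntegral.integral_sub ((hfx x).intervalIntegrable _ _)
      ((hfx x').intervalIntegrable _ _)]
    have hbound := intervalIntegral.norm_integral_le_of_norm_le_const (a := 0)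
      (b := 2 * Real.pi) (C := ε) (f := fun y => f x y - f x' y) fun y hy => by
        rw [Set.uIoc_of_le hpi.le] at hy
        have hy' : y ∈ Set.Icc 0 (2 * Real.pi) := ⟨hy.1.le, hy.2⟩
        exact h x hx x' hx' y hy' y hy' (hxx.trans hNδ) (by rwa [sub_self, abs_zero])
    rw [sub_zero, abs_of_pos hpi, mul_comm ε] at hbound
    exact hbound
  have h1 := abs_integral_sub_riemannSum_le hgc hN hosc
  have h2 : |2 * Real.pi / N * ∑ j ∈ Finset.range N, g (gridAngle N j) -
      2 * Real.pi / N * ∑ j ∈ Finset.range N, 2 * Real.pi / M * ∑ l ∈ Finset.range M,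
        f (gridAngle N j) (gridAngle M l)| ≤ 2 * Real.pi * (2 * Real.pi * ε) := by
    rw [← mul_sub, ← Finset.sum_sub_distrib, abs_mul, abs_of_nonneg (by positivity)]
    have h3 : |∑ j ∈ Finset.range N, (g (gridAngle N j) - 2 * Real.pi / M *
        ∑ l ∈ Finset.range M, f (gridAngle N j) (gridAngle M l))| ≤ N * (2 * Real.pi * ε) := by
      refine (Finset.abs_sum_le_sum_abs _ _).trans ?_
      refine (Finset.sum_le_sum fun j hj => ?_).trans
        (le_of_eq (by rw [Finset.sum_const, Finset.card_range, nsmul_eq_mul]))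
      have hmj := gridAngle_mem hN (Finset.mem_range.mp hj).le
      exact abs_integral_sub_riemannSum_le (hfx _) hM fun y hy y' hy' hyy =>
        h _ hmj _ hmj y hy y' hy' (by rwa [sub_self, abs_zero]) (hyy.trans hMδ)
    calc 2 * Real.pi / N * _ ≤ 2 * Real.pi / N * (N * (2 * Real.pi * ε)) :=
          mul_le_mul_of_nonneg_left h3 (by positivity)
      _ = 2 * Real.pi * (2 * Real.pi * ε) := by field_simp
  calc _ ≤ 2 * Real.pi * (2 * Real.pi * ε) + 2 * Real.pi * (2 * Real.pi * ε) :=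
        (abs_sub_le _ _ _).trans (add_le_add h1 h2)
    _ = _ := by ring

/-- The averages of a continuous function over uniform grids on the torus converge to its mean,
jointly in the two grid sizes. -/
theorem tendsto_gridAverage {f : ℝ → ℝ → ℝ} (hf : Continuous (Function.uncurry f)) :
    Tendsto (fun p : ℕ × ℕ => (∑ j ∈ Finset.range (p.1 + 1), ∑ l ∈ Finset.range (p.2 + 1),
        f (gridAngle (p.1 + 1) j) (gridAngle (p.2 + 1) l)) / (((p.1 : ℝ) + 1) * ((p.2 : ℝ) + 1)))
      (atTop ×ˢ atTop)
      (𝓝 (((2 * Real.pi) ^ 2)⁻¹ *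
        ∫ x in (0 : ℝ)..(2 * Real.pi), ∫ y in (0 : ℝ)..(2 * Real.pi), f x y)) := by
  have hpi := Real.two_pi_pos
  rw [Metric.tendsto_nhds]
  intro ε hε
  have huc := (isCompact_Icc (a := (0 : ℝ)) (b := 2 * Real.pi)).prod
    (isCompact_Icc (a := (0 : ℝ)) (b := 2 * Real.pi)) |>.uniformContinuousOn_of_continuous
    hf.continuousOn
  -- The two-variable bound doubles the oscillation, so `ε / 3` ends at `2ε / 3 < ε`.
  obtain ⟨δ, hδ, hfδ⟩ := Metric.uniformContinuousOn_iff.mp huc (ε / 3) (by positivity)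
  have hsmall : ∀ᶠ n : ℕ in atTop, 2 * Real.pi / ((n + 1 : ℕ) : ℝ) ≤ δ / 2 := by
    have h := (tendsto_const_div_atTop_nhds_zero_nat (2 * Real.pi)).comp (tendsto_add_atTop_nat 1)
    exact h.eventually_le_const (by positivity)
  filter_upwards [hsmall.prod_mk hsmall] with p hp
  have hbound := abs_integral_integral_sub_riemannSum_le hf (Nat.succ_pos p.1) (Nat.succ_pos p.2)
    (ε := ε / 3) hp.1 hp.2 (fun x hx x' hx' y hy y' hy' hxx hyy => by
      have := hfδ (x, y) ⟨hx, hy⟩ (x', y') ⟨hx', hy'⟩ (by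
        rw [Prod.dist_eq, max_lt_iff, Real.dist_eq, Real.dist_eq]
        exact ⟨by linarith, by linarith⟩)
      exact this.le) (by positivity)
  set I := ∫ x in (0 : ℝ)..(2 * Real.pi), ∫ y in (0 : ℝ)..(2 * Real.pi), f x y
  set S := ∑ j ∈ Finset.range (p.1 + 1), ∑ l ∈ Finset.range (p.2 + 1),
        f (gridAngle (p.1 + 1) j) (gridAngle (p.2 + 1) l) with hS
  have hsum : 2 * Real.pi / ((p.1 + 1 : ℕ) : ℝ) * ∑ j ∈ Finset.range (p.1 + 1),
      2 * Real.pi / ((p.2 + 1 : ℕ) : ℝ) * ∑ l ∈ Finset.range (p.2 + 1),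
        f (gridAngle (p.1 + 1) j) (gridAngle (p.2 + 1) l) =
      (2 * Real.pi) ^ 2 * (S / (((p.1 : ℝ) + 1) * ((p.2 : ℝ) + 1))) := by
    rw [← Finset.mul_sum, ← hS]
    push_cast
    field_simp
  rw [hsum] at hbound
  rw [Real.dist_eq, abs_sub_comm]
  have hfac : ((2 * Real.pi) ^ 2)⁻¹ * I - S / (((p.1 : ℝ) + 1) * ((p.2 : ℝ) + 1)) =
      ((2 * Real.pi) ^ 2)⁻¹ *
        (I - (2 * Real.pi) ^ 2 * (S / (((p.1 : ℝ) + 1) * ((p.2 : ℝ) + 1)))) := by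
    rw [mul_sub, inv_mul_cancel_left₀ (by positivity)]
  rw [hfac, abs_mul, abs_of_nonneg (by positivity)]
  calc _ ≤ ((2 * Real.pi) ^ 2)⁻¹ * (2 * (2 * Real.pi) ^ 2 * (ε / 3)) :=
        mul_le_mul_of_nonneg_left hbound (by positivity)
    _ = 2 * ε / 3 := by field_simp
    _ < ε := by linarith

end RiemannSums

end CliqueInsertedLattice

/-! ### The three limits. -/

namespace CliqueInsertedLattice

open Filter Topology MeasureTheory

theorem continuous_energySymbol : Continuous (Function.uncurry energySymbol) := by
  unfold energySymbol hexSymbol Function.uncurry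
  fun_prop

theorem tendsto_succ_div : Tendsto (fun n : ℕ => ((n : ℝ) + 1) / n) atTop (𝓝 1) := by
  have h := tendsto_one_div_atTop_nhds_zero_nat (𝕜 := ℝ)
  have h1 := h.const_add 1
  rw [add_zero] at h1
  refine h1.congr' ?_
  filter_upwards [eventually_ge_atTop 1] with n hn
  have : (n : ℝ) ≠ 0 := by positivity
  field_simp

theorem tendsto_energy_toroidalLattice :
    Tendsto (fun p : ℕ × ℕ => energy (toroidalLattice p.1 p.2) / (6 * (p.1 : ℝ) * (p.2 : ℝ)))
      (atTop ×ˢ atTop) (𝓝 asymptoticEnergy) := by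
  have hmean := tendsto_gridAverage continuous_energySymbol
  have hratio : Tendsto (fun p : ℕ × ℕ => (((p.1 : ℝ) + 1) / p.1) * (((p.2 : ℝ) + 1) / p.2))
      (atTop ×ˢ atTop) (𝓝 (1 * 1)) :=
    (tendsto_succ_div.comp tendsto_fst).mul (tendsto_succ_div.comp tendsto_snd)
  have hlim := hratio.mul ((hmean.const_add 2).div_const 6)
  have hval : (1 * 1 : ℝ) * ((2 + ((2 * Real.pi) ^ 2)⁻¹ *
      ∫ x in (0 : ℝ)..(2 * Real.pi), ∫ y in (0 : ℝ)..(2 * Real.pi), energySymbol x y) / 6) =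
      asymptoticEnergy := by
    simp only [asymptoticEnergy, energySymbol]
    field_simp
    ring
  rw [hval] at hlim
  refine hlim.congr' ?_
  filter_upwards [(eventually_ge_atTop 1).prod_mk (eventually_ge_atTop 1)] with p hp
  have h1 : (p.1 : ℝ) ≠ 0 := Nat.cast_ne_zero.mpr (by have := hp.1; omega)
  have h2 : (p.2 : ℝ) ≠ 0 := Nat.cast_ne_zero.mpr (by have := hp.2; omega)
  rw [energy_toroidalLattice hp.1 hp.2]
  simp only [Finset.sum_add_distrib, Finset.sum_const, Finset.card_range, nsmul_eq_mul]
  push_cast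
  field_simp

/-- Deleting a set of at most `#J` edges between paired darts changes the energy by at most
`2 * #J`. -/
theorem abs_energy_deleteEdges_dart_sub_le {V J : Type*} [Fintype J] {H : SimpleGraph V}
    [Fintype H.Dart] (G : SimpleGraph H.Dart) (u v : J → V) :
    |energy (G.deleteEdges {e | ∃ d : H.Dart, ∃ j, d.fst = u j ∧ d.snd = v j ∧ e = s(d, d.symm)}) -
      energy G| ≤ 2 * Fintype.card J := by
  classical
  set D : Finset H.Dart := {d | ∃ j, d.fst = u j ∧ d.snd = v j} with hD
  have hDcard : D.card ≤ Fintype.card J := by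
    refine Finset.card_le_card_of_forall_subsingleton (fun d j => d.fst = u j ∧ d.snd = v j)
      (fun d hd => ?_) fun j _ d hd d' hd' => ?_
    · obtain ⟨j, hj⟩ := (Finset.mem_filter.mp hd).2
      exact ⟨j, Finset.mem_univ _, hj⟩
    · exact SimpleGraph.Dart.ext _ _
        (Prod.ext (hd.2.1.trans hd'.2.1.symm) (hd.2.2.trans hd'.2.2.symm))
  -- Both ends of each deleted edge must be counted, since it accounts for two matrix entries.
  have hT : (D ∪ D.image SimpleGraph.Dart.symm).card ≤ 2 * Fintype.card J := by
    refine (Finset.card_union_le _ _).trans ?_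
    have := Finset.card_image_le (s := D) (f := SimpleGraph.Dart.symm)
    omega
  refine (abs_energy_deleteEdges_sub_le G _ (D ∪ D.image SimpleGraph.Dart.symm)
    SimpleGraph.Dart.symm ?_).trans (by exact_mod_cast hT)
  rintro a b ⟨d, j, h1, h2, h⟩
  have hd : d ∈ D := Finset.mem_filter.mpr ⟨Finset.mem_univ _, j, h1, h2⟩
  rcases Sym2.eq_iff.mp h with ⟨rfl, rfl⟩ | ⟨rfl, rfl⟩
  · exact ⟨Finset.mem_union_left _ hd, rfl⟩
  · exact ⟨Finset.mem_union_right _ (Finset.mem_image_of_mem _ hd),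
      (SimpleGraph.Dart.symm_symm _).symm⟩

theorem abs_energy_cylindricalLattice_sub_le (n m : ℕ) :
    |energy (cylindricalLattice n m) - energy (toroidalLattice n m)| ≤ 2 * ((n : ℝ) + 1) := by
  have h := abs_energy_deleteEdges_dart_sub_le (toroidalLattice n m)
    (fun i : ZMod (n + 1) => (Sum.inl (i, 0) : HexVertex n m)) (fun i => Sum.inr (i, -1))
  rw [ZMod.card] at h
  exact_mod_cast h

theorem abs_energy_freeLattice_sub_le (n m : ℕ) :
    |energy (freeLattice n m) - energy (cylindricalLattice n m)| ≤ 2 * ((m : ℝ) + 1) := by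
  have h := abs_energy_deleteEdges_dart_sub_le (cylindricalLattice n m)
    (fun j : ZMod (m + 1) => (Sum.inl (-1, j) : HexVertex n m)) (fun j => Sum.inr (0, j))
  rw [ZMod.card] at h
  exact_mod_cast h

/-- An energy perturbation of the order of the boundary does not change the limit per vertex. -/
theorem tendsto_energy_of_abs_sub_le {e e' : ℕ → ℕ → ℝ} {L : ℝ}
    (h : Tendsto (fun p : ℕ × ℕ => e p.1 p.2 / (6 * (p.1 : ℝ) * (p.2 : ℝ)))
      (atTop ×ˢ atTop) (𝓝 L))
    (hbound : ∀ n m : ℕ, |e' n m - e n m| ≤ 2 * ((n : ℝ) + 1) + 2 * ((m : ℝ) + 1)) :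
    Tendsto (fun p : ℕ × ℕ => e' p.1 p.2 / (6 * (p.1 : ℝ) * (p.2 : ℝ)))
      (atTop ×ˢ atTop) (𝓝 L) := by
  have hinv := tendsto_one_div_atTop_nhds_zero_nat (𝕜 := ℝ)
  have hb : Tendsto (fun p : ℕ × ℕ => (((p.1 : ℝ) + 1) / p.1) * (1 / (p.2 : ℝ)) +
      (((p.2 : ℝ) + 1) / p.2) * (1 / (p.1 : ℝ))) (atTop ×ˢ atTop) (𝓝 (1 * 0 + 1 * 0)) :=
    ((tendsto_succ_div.comp tendsto_fst).mul (hinv.comp tendsto_snd)).add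
      ((tendsto_succ_div.comp tendsto_snd).mul (hinv.comp tendsto_fst))
  rw [show (1 * 0 + 1 * 0 : ℝ) = 0 by norm_num] at hb
  have hdiff : Tendsto (fun p : ℕ × ℕ => (e' p.1 p.2 - e p.1 p.2) / (6 * (p.1 : ℝ) * (p.2 : ℝ)))
      (atTop ×ˢ atTop) (𝓝 0) := by
    refine squeeze_zero_norm (fun p => ?_) hb
    rw [Real.norm_eq_abs, abs_div, abs_of_nonneg (show 0 ≤ 6 * (p.1 : ℝ) * p.2 by positivity)]
    calc |e' p.1 p.2 - e p.1 p.2| / (6 * (p.1 : ℝ) * p.2)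
        ≤ (2 * ((p.1 : ℝ) + 1) + 2 * ((p.2 : ℝ) + 1)) / (6 * (p.1 : ℝ) * p.2) :=
          div_le_div_of_nonneg_right (hbound p.1 p.2) (by positivity)
      _ = 1 / 3 * ((((p.1 : ℝ) + 1) / p.1) * (1 / (p.2 : ℝ)) +
            (((p.2 : ℝ) + 1) / p.2) * (1 / (p.1 : ℝ))) := by
          -- With inverses the identity also holds at `p.1 = 0` or `p.2 = 0`, where division returns
          -- `0`.
          rw [div_eq_mul_inv, mul_inv, mul_inv]
          ring
      _ ≤ _ := mul_le_of_le_one_left (by positivity) (by norm_num)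
  have hadd := h.add hdiff
  rw [add_zero] at hadd
  exact hadd.congr fun p => by ring

theorem tendsto_energy_cylindricalLattice :
    Tendsto (fun p : ℕ × ℕ => energy (cylindricalLattice p.1 p.2) / (6 * (p.1 : ℝ) * (p.2 : ℝ)))
      (atTop ×ˢ atTop) (𝓝 asymptoticEnergy) :=
  tendsto_energy_of_abs_sub_le (e := fun n m => energy (toroidalLattice n m))
    (e' := fun n m => energy (cylindricalLattice n m)) tendsto_energy_toroidalLattice fun n m =>
      (abs_energy_cylindricalLattice_sub_le n m).trans (le_add_of_nonneg_right (by positivity))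

theorem tendsto_energy_freeLattice :
    Tendsto (fun p : ℕ × ℕ => energy (freeLattice p.1 p.2) / (6 * (p.1 : ℝ) * (p.2 : ℝ)))
      (atTop ×ˢ atTop) (𝓝 asymptoticEnergy) :=
  tendsto_energy_of_abs_sub_le (e := fun n m => energy (cylindricalLattice n m))
    (e' := fun n m => energy (freeLattice n m)) tendsto_energy_cylindricalLattice fun n m =>
      (abs_energy_freeLattice_sub_le n m).trans (le_add_of_nonneg_left (by positivity))

end CliqueInsertedLattice

/-! ### Exact moments of the squared hexagonal symbol. -/

namespace CliqueInsertedLattice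

open MeasureTheory

theorem integral_cos_pow_add_two (k : ℕ) :
    ∫ x in (0 : ℝ)..(2 * Real.pi), Real.cos x ^ (k + 2) =
      (k + 1) / (k + 2) * ∫ x in (0 : ℝ)..(2 * Real.pi), Real.cos x ^ k := by
  rw [integral_cos_pow]
  simp

theorem integral_cos_poly (c0 c1 c2 c3 c4 c5 c6 : ℝ) :
    ∫ x in (0 : ℝ)..(2 * Real.pi), (c0 + c1 * Real.cos x + c2 * Real.cos x ^ 2 +
      c3 * Real.cos x ^ 3 + c4 * Real.cos x ^ 4 + c5 * Real.cos x ^ 5 + c6 * Real.cos x ^ 6) =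
      2 * Real.pi * (c0 + c2 / 2 + 3 * c4 / 8 + 5 * c6 / 16) := by
  have C1 : ∫ x in (0 : ℝ)..(2 * Real.pi), Real.cos x = 0 := by simp
  have C2 := integral_cos_pow_add_two 0
  have C3 := integral_cos_pow_add_two 1
  have C4 := integral_cos_pow_add_two 2
  have C5 := integral_cos_pow_add_two 3
  have C6 := integral_cos_pow_add_two 4
  norm_num only [pow_zero, pow_one] at C2 C3 C4 C5 C6
  rw [C1] at C3
  rw [intervalIntegral.integral_const] at C2
  rw [C2] at C4
  rw [C3] at C5
  rw [C4] at C6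
  iterate 6 rw [intervalIntegral.integral_add (Continuous.intervalIntegrable (by fun_prop) _ _)
    (Continuous.intervalIntegrable (by fun_prop) _ _)]
  simp only [intervalIntegral.integral_const_mul, intervalIntegral.integral_const, smul_eq_mul, C1,
    C2, C3, C4, C5, C6]
  ring

theorem integral_cos_add_poly (s c0 c1 c2 c3 c4 c5 c6 : ℝ) :
    ∫ x in (0 : ℝ)..(2 * Real.pi), (c0 + c1 * Real.cos (x + s) + c2 * Real.cos (x + s) ^ 2 +
      c3 * Real.cos (x + s) ^ 3 + c4 * Real.cos (x + s) ^ 4 + c5 * Real.cos (x + s) ^ 5 +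
      c6 * Real.cos (x + s) ^ 6) = 2 * Real.pi * (c0 + c2 / 2 + 3 * c4 / 8 + 5 * c6 / 16) := by
  set F : ℝ → ℝ := fun x => c0 + c1 * Real.cos x + c2 * Real.cos x ^ 2 + c3 * Real.cos x ^ 3 +
    c4 * Real.cos x ^ 4 + c5 * Real.cos x ^ 5 + c6 * Real.cos x ^ 6 with hF
  have hper : Function.Periodic F (2 * Real.pi) := fun x => by
    simp only [hF, Real.cos_add_two_pi]
  have h1 := intervalIntegral.integral_comp_add_right (a := 0) (b := 2 * Real.pi) F s
  have h2 := hper.intervalIntegral_add_eq s 0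
  rw [zero_add, add_comm (2 * Real.pi)] at h1
  rw [zero_add] at h2
  rw [← integral_cos_poly c0 c1 c2 c3 c4 c5 c6]
  exact h1.trans h2

/-- For fixed `x` the symbol is affine in one shifted cosine, so averaging over `y` needs only
moments of cosine. Only even powers of `cos (x / 2)` survive, leaving a polynomial in `cos x`. -/
theorem hexSymbolSq_eq_cos_shift (x y : ℝ) :
    hexSymbolSq x y = (3 + 2 * Real.cos x) + 4 * Real.cos (x / 2) * Real.cos (y + x / 2) := by
  have h := Real.cos_add_cos (x + y) y
  rw [show (x + y + y) / 2 = y + x / 2 by ring, show (x + y - y) / 2 = x / 2 by ring] at h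
  rw [hexSymbolSq]
  linear_combination 2 * h

/-- The polynomial of degree at most six with coefficients `c`. -/
def sextic (c : Fin 7 → ℝ) (t : ℝ) : ℝ :=
  c 0 + c 1 * t + c 2 * t ^ 2 + c 3 * t ^ 3 + c 4 * t ^ 4 + c 5 * t ^ 5 + c 6 * t ^ 6

theorem continuous_sextic (c : Fin 7 → ℝ) : Continuous (sextic c) := by
  unfold sextic
  fun_prop

theorem integral_sextic_hexSymbolSq (c : Fin 7 → ℝ) (x : ℝ) :
    ∫ y in (0 : ℝ)..(2 * Real.pi), sextic c (hexSymbolSq x y) = 2 * Real.pi * (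
      (c 0 + 3 * c 1 + 13 * c 2 + 63 * c 3 + 321 * c 4 + 1683 * c 5 + 8989 * c 6) +
      (2 * c 1 + 16 * c 2 + 114 * c 3 + 768 * c 4 + 5010 * c 5 + 32016 * c 6) * Real.cos x +
      (4 * c 2 + 60 * c 3 + 624 * c 4 + 5520 * c 5 + 44580 * c 6) * Real.cos x ^ 2 +
      (8 * c 3 + 192 * c 4 + 2720 * c 5 + 30400 * c 6) * Real.cos x ^ 3 +
      (16 * c 4 + 560 * c 5 + 10320 * c 6) * Real.cos x ^ 4 +
      (32 * c 5 + 1536 * c 6) * Real.cos x ^ 5 +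
      (64 * c 6) * Real.cos x ^ 6) := by
  set a := 3 + 2 * Real.cos x with ha
  set b := 4 * Real.cos (x / 2) with hb
  have hcos : Real.cos x = 2 * Real.cos (x / 2) ^ 2 - 1 := by
    rw [← Real.cos_two_mul]
    congr 1
    ring
  have key := integral_cos_add_poly (x / 2)
    (c 0 + c 1 * a + c 2 * a ^ 2 + c 3 * a ^ 3 + c 4 * a ^ 4 + c 5 * a ^ 5 + c 6 * a ^ 6)
    (c 1 * b + 2 * c 2 * a * b + 3 * c 3 * a ^ 2 * b + 4 * c 4 * a ^ 3 * b +
      5 * c 5 * a ^ 4 * b + 6 * c 6 * a ^ 5 * b)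
    (c 2 * b ^ 2 + 3 * c 3 * a * b ^ 2 + 6 * c 4 * a ^ 2 * b ^ 2 +
      10 * c 5 * a ^ 3 * b ^ 2 + 15 * c 6 * a ^ 4 * b ^ 2)
    (c 3 * b ^ 3 + 4 * c 4 * a * b ^ 3 + 10 * c 5 * a ^ 2 * b ^ 3 + 20 * c 6 * a ^ 3 * b ^ 3)
    (c 4 * b ^ 4 + 5 * c 5 * a * b ^ 4 + 15 * c 6 * a ^ 2 * b ^ 4)
    (c 5 * b ^ 5 + 6 * c 6 * a * b ^ 5)
    (c 6 * b ^ 6)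
  have heq : ∀ y, hexSymbolSq x y = a + b * Real.cos (y + x / 2) := hexSymbolSq_eq_cos_shift x
  simp only [heq, sextic]
  calc _ = _ := by
        refine Eq.trans ?_ key
        congr 1
        ext y
        ring
    _ = _ := by
        rw [ha, hb, hcos]
        ring

/-- The moments `1, 3, 15, 93, …` of the squared hexagonal symbol. -/
theorem integral_integral_sextic_hexSymbolSq (c : Fin 7 → ℝ) :
    ∫ x in (0 : ℝ)..(2 * Real.pi), ∫ y in (0 : ℝ)..(2 * Real.pi), sextic c (hexSymbolSq x y) =
      (2 * Real.pi) ^ 2 *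
        (c 0 + 3 * c 1 + 15 * c 2 + 93 * c 3 + 639 * c 4 + 4653 * c 5 + 35169 * c 6) := by
  simp only [integral_sextic_hexSymbolSq]
  rw [intervalIntegral.integral_const_mul, integral_cos_poly]
  ring

/-! ### Polynomial bounds and the numerical value. -/

/-- The squared hexagonal symbol at which the energy symbol equals `6 + w`. -/
noncomputable def squaredSymbolOfExcess (w : ℝ) : ℝ := (169 - (((6 + w) ^ 2 - 26) / 2) ^ 2) / 16

/-- Integer coefficients of a multiple of a Hermite interpolation polynomial that bounds the energy
symbol from above. -/
def upperCoeff : Fin 7 → ℝ :=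
  ![94078593879143397052998780065296956641658202807623,
    -1113701482725089203643353357586371064112524744538,
    -31341994972506709253123051325951462542816915349,
    -3074033175503355623487680709202693462086728384,
    357683175752910136828888601857598129134080000,
    -54163018086872259650918871280885862400000000,
    0]

theorem le_sextic_upperCoeff {w : ℝ} (hw : 0 ≤ w) :
    13046350715172902873296460578933440447737767512750 * (6 + w) ≤
      sextic upperCoeff (squaredSymbolOfExcess w) := by
  -- Double contact at `w = 1/3, 1, 6/5`, inside the range `0 ≤ w ≤ 2√13 - 6` of the excess,
  -- determines a quintic in `t`. In the variable `w` the data are rational, and the cofactor has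
  -- positive coefficients.
  have h : sextic upperCoeff (squaredSymbolOfExcess w) -
      13046350715172902873296460578933440447737767512750 * (6 + w) =
      (w - 1 / 3) ^ 2 * (w - 1) ^ 2 * (w - 6 / 5) ^ 2 * (
      912448293551941431322372909567590092378617344225
      + 5247046299445779658531299782882766689215916607825 / 4 * w
      + 58894423142347417789150817882785010180199710619975 / 64 * w ^ 2
      + 52498813152761568356451814600285814675203896942975 / 128 * w ^ 3
      + 131315490252697277125197559773688995424862642264175 / 1024 * w ^ 4
      + 30224870055368934416777575387803996108018264733425 / 1024 * w ^ 5
      + 21006504490952903177267838391956505474183487368875 / 4096 * w ^ 6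
      + 87111957170722033840846034129602075733209333725 / 128 * w ^ 7
      + 141520860134955034920686904044978853086585705325 / 2048 * w ^ 8
      + 682296550979128224713772836077928952592570125 / 128 * w ^ 9
      + 314341689931798984586683608987943279518448125 / 1024 * w ^ 10
      + 3272034525293481058610488860587978690840625 / 256 * w ^ 11
      + 744165730120470320776558529789828254828125 / 2048 * w ^ 12
      + 6460178498012056929596189023522814296875 / 1024 * w ^ 13
      + 206615516993989027599025235293906640625 / 4096 * w ^ 14) := by
    simp only [sextic, upperCoeff, squaredSymbolOfExcess, Matrix.cons_val_zero, Matrix.cons_val_one,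
      Matrix.cons_val]
    ring
  rw [← sub_nonneg, h]
  positivity

/-- Integer coefficients of a multiple of a Hermite interpolation polynomial that bounds the energy
symbol from below. -/
def lowerCoeff : Fin 7 → ℝ :=
  ![166532852895480145814535173244884527410372418181938504893,
    -1969889007970240409900282525634296435010312516999038586,
    -62633673652561217509269959552732871985428228921646659,
    1498384712831943717120516636424621739943607655501952,
    -1935150552041399102286837740142147232117992612999168,
    289985532507539252625576610130617706322104156160000,
    -20107452473066240982053924060318090972364800000000]

theorem sextic_lowerCoeff_le {w : ℝ} (hw : 0 ≤ w) :
    sextic lowerCoeff (squaredSymbolOfExcess w) ≤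
      23093959166816713353567105300058126079853677678926500000 * (6 + w) := by
  -- Simple contact at the endpoint `w = 0` (that is, `t = 9`) and double contact at `1/2, 1, 6/5`
  -- give seven conditions, hence a sextic.
  have h : 23093959166816713353567105300058126079853677678926500000 * (6 + w) -
      sextic lowerCoeff (squaredSymbolOfExcess w) =
      w * (w - 1 / 2) ^ 2 * (w - 1) ^ 2 * (w - 6 / 5) ^ 2 * (
      1784667503307481007939382282679896292675027804186687500
      + 54272521386865730663563233686573094819781711863282451875 / 16 * w
      + 100438168588840888240671019070432145426683283247576033875 / 32 * w ^ 2
      + 474827971947811953168320108297435573600517594284779400175 / 256 * w ^ 3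
      + 199032463327085509162138279245439797852055374104476669275 / 256 * w ^ 4
      + 249737667163495566087412995583870844987441961726012311775 / 1024 * w ^ 5
      + 30227986431614612677256318289516762004771741580415457575 / 512 * w ^ 6
      + 11501159600119009606859359011724269984262912525710116625 / 1024 * w ^ 7
      + 434220467877711393545074741132327327441900404856311375 / 256 * w ^ 8
      + 209061486372254833869559410863074526434070147689505225 / 1024 * w ^ 9
      + 10015599963232049837543703276217373864065008693516975 / 512 * w ^ 10
      + 1517688935546437195264247970042122404741498225842175 / 1024 * w ^ 11
      + 22437847007565332599456694205155966433056801342625 / 256 * w ^ 12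
      + 1013406718299992994124736880478165697267915968125 / 256 * w ^ 13
      + 1054535420611110097058459651591919459554971875 / 8 * w ^ 14
      + 195109223339758502487737841693988394447828125 / 64 * w ^ 15
      + 699435686570614670105012192998901659453125 / 16 * w ^ 16
      + 4681631101543605556258448413647266796875 / 16 * w ^ 17) := by
    simp only [sextic, lowerCoeff, squaredSymbolOfExcess, Matrix.cons_val_zero, Matrix.cons_val_one,
      Matrix.cons_val]
    ring
  rw [← sub_nonneg, h]
  positivity

/-- With `p`, `q` the two square roots, `(p + q)² = 26 + 2pq` and `(pq)² = 169 - 16t`, so `t` is a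
polynomial in `p + q`. From `t ≤ 9` follow `pq ≥ 5` and `p + q ≥ 6`. -/
theorem exists_energySymbol_eq (x y : ℝ) :
    ∃ w, 0 ≤ w ∧ energySymbol x y = 6 + w ∧ squaredSymbolOfExcess w = hexSymbolSq x y := by
  have ht : hexSymbol x y ^ 2 = hexSymbolSq x y := Real.sq_sqrt (hexSymbolSq_nonneg x y)
  have h0 : 0 ≤ hexSymbol x y := Real.sqrt_nonneg _
  have h3 : hexSymbol x y ≤ 3 := sqrt_le_three (hexSymbolSq_le x y)
  set h := hexSymbol x y with hh
  have hp := Real.sq_sqrt (show 0 ≤ 13 + 4 * h by positivity)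
  have hm := Real.sq_sqrt (show 0 ≤ 13 - 4 * h by linarith)
  have hp0 := Real.sqrt_nonneg (13 + 4 * h)
  have hm1 : 1 ≤ √(13 - 4 * h) := Real.one_le_sqrt.mpr (by linarith)
  have hE : energySymbol x y = √(13 + 4 * h) + √(13 - 4 * h) := rfl
  set p := √(13 + 4 * h)
  set q := √(13 - 4 * h)
  have hpq : (p * q) ^ 2 = 169 - 16 * hexSymbolSq x y := by
    rw [mul_pow, hp, hm, ← ht]
    ring
  have hpq5 : 5 ≤ p * q := by
    refine le_of_sq_le_sq ?_ (by positivity)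
    rw [hpq]
    linarith [hexSymbolSq_le x y]
  refine ⟨p + q - 6, ?_, by rw [hE]; ring, ?_⟩
  · have : (6 : ℝ) ^ 2 ≤ (p + q) ^ 2 := by nlinarith
    have := le_of_sq_le_sq this (by positivity)
    linarith
  · have hs : ((6 + (p + q - 6)) ^ 2 - 26) / 2 = p * q := by linear_combination (hp + hm) / 2
    rw [squaredSymbolOfExcess, hs, hpq]
    ring

theorem integral_integral_mono {f g : ℝ → ℝ → ℝ} (hf : Continuous (Function.uncurry f))
    (hg : Continuous (Function.uncurry g)) (h : ∀ x y, f x y ≤ g x y) :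
    ∫ x in (0 : ℝ)..(2 * Real.pi), ∫ y in (0 : ℝ)..(2 * Real.pi), f x y ≤
      ∫ x in (0 : ℝ)..(2 * Real.pi), ∫ y in (0 : ℝ)..(2 * Real.pi), g x y := by
  refine intervalIntegral.integral_mono Real.two_pi_pos.le
    (Continuous.intervalIntegrable
      (intervalIntegral.continuous_parametric_intervalIntegral_of_continuous' hf _ _) _ _)
    (Continuous.intervalIntegrable
      (intervalIntegral.continuous_parametric_intervalIntegral_of_continuous' hg _ _) _ _)
    fun x => intervalIntegral.integral_mono Real.two_pi_pos.le
      ((hf.comp (Continuous.prodMk_right x)).intervalIntegrable _ _)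
      ((hg.comp (Continuous.prodMk_right x)).intervalIntegrable _ _) fun y => h x y

theorem continuous_hexSymbolSq : Continuous (Function.uncurry hexSymbolSq) := by
  unfold hexSymbolSq Function.uncurry
  fun_prop

theorem asymptoticEnergy_eq : asymptoticEnergy = 1 / 3 + 1 / (24 * Real.pi ^ 2) *
    ∫ x in (0 : ℝ)..(2 * Real.pi), ∫ y in (0 : ℝ)..(2 * Real.pi), energySymbol x y := rfl

theorem asymptoticEnergy_le_of_le_sextic {D : ℝ} (hD : 0 < D) {c : Fin 7 → ℝ}
    (h : ∀ w, 0 ≤ w → D * (6 + w) ≤ sextic c (squaredSymbolOfExcess w)) :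
    asymptoticEnergy ≤ 1 / 3 +
      (c 0 + 3 * c 1 + 15 * c 2 + 93 * c 3 + 639 * c 4 + 4653 * c 5 + 35169 * c 6) / (6 * D) := by
  have hmono := integral_integral_mono (f := fun x y => D * energySymbol x y)
    (g := fun x y => sextic c (hexSymbolSq x y)) (continuous_const.mul continuous_energySymbol)
    ((continuous_sextic c).comp continuous_hexSymbolSq) fun x y => by
      obtain ⟨w, hw, h1, h2⟩ := exists_energySymbol_eq x y
      rw [h1, ← h2]
      exact h w hw
  rw [integral_integral_sextic_hexSymbolSq] at hmono
  simp only [intervalIntegral.integral_const_mul] at hmono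
  have hpi := Real.pi_pos
  rw [asymptoticEnergy_eq, add_le_add_iff_left, one_div_mul_eq_div,
    div_le_div_iff₀ (by positivity) (by positivity)]
  linarith

theorem le_asymptoticEnergy_of_sextic_le {D : ℝ} (hD : 0 < D) {c : Fin 7 → ℝ}
    (h : ∀ w, 0 ≤ w → sextic c (squaredSymbolOfExcess w) ≤ D * (6 + w)) :
    1 / 3 + (c 0 + 3 * c 1 + 15 * c 2 + 93 * c 3 + 639 * c 4 + 4653 * c 5 + 35169 * c 6) /
      (6 * D) ≤ asymptoticEnergy := by
  have hmono := integral_integral_mono (f := fun x y => sextic c (hexSymbolSq x y))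
    (g := fun x y => D * energySymbol x y) ((continuous_sextic c).comp continuous_hexSymbolSq)
    (continuous_const.mul continuous_energySymbol) fun x y => by
      obtain ⟨w, hw, h1, h2⟩ := exists_energySymbol_eq x y
      rw [h1, ← h2]
      exact h w hw
  rw [integral_integral_sextic_hexSymbolSq] at hmono
  simp only [intervalIntegral.integral_const_mul] at hmono
  have hpi := Real.pi_pos
  rw [asymptoticEnergy_eq, add_le_add_iff_left, one_div_mul_eq_div,
    div_le_div_iff₀ (by positivity) (by positivity)]
  linarith

theorem abs_asymptoticEnergy_sub_lt : |asymptoticEnergy - 1.4825| < 0.00005 := by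
  have hu := asymptoticEnergy_le_of_le_sextic (by norm_num) fun _ => le_sextic_upperCoeff
  have hl := le_asymptoticEnergy_of_sextic_le (by norm_num) fun _ => sextic_lowerCoeff_le
  simp only [upperCoeff, lowerCoeff, Matrix.cons_val_zero, Matrix.cons_val_one,
    Matrix.cons_val] at hu hl
  rw [abs_lt]
  constructor
  · norm_num at hl ⊢
    linarith
  · norm_num at hu ⊢
    linarith

end CliqueInsertedLattice

open CliqueInsertedLattice in
theorem theorem2p4 :
    Filter.Tendsto
        (fun p : ℕ × ℕ => energy (toroidalLattice p.1 p.2) / (6 * (p.1 : ℝ) * (p.2 : ℝ)))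
        (Filter.atTop ×ˢ Filter.atTop) (nhds asymptoticEnergy) ∧
      Filter.Tendsto
        (fun p : ℕ × ℕ => energy (cylindricalLattice p.1 p.2) / (6 * (p.1 : ℝ) * (p.2 : ℝ)))
        (Filter.atTop ×ˢ Filter.atTop) (nhds asymptoticEnergy) ∧
      Filter.Tendsto
        (fun p : ℕ × ℕ => energy (freeLattice p.1 p.2) / (6 * (p.1 : ℝ) * (p.2 : ℝ)))
        (Filter.atTop ×ˢ Filter.atTop) (nhds asymptoticEnergy) ∧
      |asymptoticEnergy - 1.4825| < 0.00005 :=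
  ⟨tendsto_energy_toroidalLattice, tendsto_energy_cylindricalLattice, tendsto_energy_freeLattice,
    abs_asymptoticEnergy_sub_lt⟩
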